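/- For real $\sigma$, $t$, $\delta$ with $0<\sigma<1$, $0<\delta<1$ and $t>1$, put $s=\sigma+it$, $T=t/(2\pi)$, let $[x]$ be the integer part of $x$, and define $$S_1(\sigma,t,\delta)=\sum_{1\le m_1\le \frac{[T]}{t^{1-\delta}-1}-1}\ \ \sum_{(t^{1-\delta}-1)m_1<m_2\le [T]}\frac{1}{m_1^{s}(m_1+m_2)^{\bar s}},$$ where $m_1,m_2$ run over positive integers. Then there is a function $\tilde G(\sigma,t,\delta)$ such that, for all fixed $\sigma,\delta\in(0,1)$, $$S_1(\sigma,t,\delta)=O\left(t^{\frac12-\sigma}\,\tilde G(\sigma,t,\delta)\right)+O\left(\frac{t^{(1-\sigma)\delta}}{t^{\sigma}}\right),\qquad t\to\infty,$$ where $$\tilde G(\sigma,t,\delta)=O\left(t^{(1-\sigma)\delta}\right)+O\left(t^{\sigma\delta}\right)\quad(\sigma\ne\tfrac12),\qquad \tilde G(\tfrac12,t,\delta)=O\left(t^{\delta/2}\ln t\right),\qquad t\to\infty.$$ The implied constants may depend on $\sigma$ and $\delta$. -/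

import Mathlib

noncomputable section

/-- The double sum `S₁(σ, t, δ)` of `1 / (m₁ ^ s * (m₁ + m₂) ^ s̄)`, where `s = σ + i t` and
`T = t / (2 π)`, over the positive integers `m₁ ≤ [T] / (t ^ (1 - δ) - 1) - 1` and the integers
`m₂` with `(t ^ (1 - δ) - 1) * m₁ < m₂ ≤ [T]`.
It is meant for `t > 1` and `0 < δ < 1`, where `t ^ (1 - δ) - 1 > 0`. -/
def doubleSumS1 (σ t δ : ℝ) : ℂ :=
  ∑ m₁ ∈ Finset.Icc 1 ⌊(⌊t / (2 * Real.pi)⌋₊ : ℝ) / (t ^ (1 - δ) - 1) - 1⌋₊,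
    ∑ m₂ ∈ Finset.Ioc ⌊(t ^ (1 - δ) - 1) * (m₁ : ℝ)⌋₊ ⌊t / (2 * Real.pi)⌋₊,
      1 / ((m₁ : ℂ) ^ ((σ : ℂ) + (t : ℂ) * Complex.I) *
        ((m₁ : ℂ) + (m₂ : ℂ)) ^ (starRingEnd ℂ ((σ : ℂ) + (t : ℂ) * Complex.I)))

end

/-! Put n = m₁ + m₂ and x = t^(1-δ). The inner sum is m₁^(-s) times a sum of n^(-σ) e(T log n) over
a range that starts at or above x m₁ and ends below 2T + 1. The phase T log n has decreasing first
differences of size T/n and second differences of size T/n².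

Where the first difference lies in [k, k+1), n has order T/(k+1), and van der Corput's second
derivative test (Kusmin–Landau away from integer slopes, trivial counting near them) gives
O(√T/(k+1)). Abel summation brings in the weight ((k+1)/T)^σ. Summing (k+1)^(σ-1) over k up to order
T/p gives O(√T p^(-σ)) for a sum starting at p.

With p ≥ x m₁ the inner sum is O(√t x^(-σ) m₁^(-2σ)), and √t x^(-σ) = t^(1/2-σ) t^(σδ). Since m₁ ≤
t^δ, the choice G = t^(σδ) ∑_{m ≤ t^δ} m^(-2σ) works, and the second error term can be taken to be
zero. -/

/-! ### Additive characters and the Kusmin–Landau inequality. -/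

/-- The additive character `e(x) = exp (2 π i x)`. -/
noncomputable def unitExp (x : ℝ) : ℂ := Complex.exp ((2 * Real.pi * x : ℝ) * Complex.I)

lemma norm_unitExp (x : ℝ) : ‖unitExp x‖ = 1 := Complex.norm_exp_ofReal_mul_I _

lemma unitExp_add (x y : ℝ) : unitExp (x + y) = unitExp x * unitExp y := by
  unfold unitExp
  rw [← Complex.exp_add]
  congr 1
  push_cast
  ring

lemma unitExp_intCast (k : ℤ) : unitExp k = 1 := by
  unfold unitExp
  rw [← Complex.exp_int_mul_two_pi_mul_I k]
  congr 1
  push_cast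
  ring

/-- The weight `1 / (1 - e(x)) = (1 + i cot (π x)) / 2`. -/
noncomputable def cotWeight (x : ℝ) : ℂ :=
  1 / 2 + ((Real.cos (Real.pi * x) / Real.sin (Real.pi * x) / 2 : ℝ) : ℂ) * Complex.I

/-- Double angle: 1 - e(x) = -2i sin(πx) exp(πix). The weight turns e(f n) into a difference of
consecutive exponentials. -/
lemma cotWeight_mul {x : ℝ} (hx : Real.sin (Real.pi * x) ≠ 0) :
    cotWeight x * (1 - unitExp x) = 1 := by
  have h2 : unitExp x = ((Real.cos (Real.pi * x) : ℂ) + (Real.sin (Real.pi * x) : ℂ) * Complex.I) ^ 2 := by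
    unfold unitExp
    rw [Complex.ofReal_cos, Complex.ofReal_sin, ← Complex.exp_mul_I, ← Complex.exp_nat_mul]
    congr 1
    push_cast
    ring
  have h1 : (Real.cos (Real.pi * x) : ℂ) ^ 2 + (Real.sin (Real.pi * x) : ℂ) ^ 2 = 1 := by
    exact_mod_cast Real.cos_sq_add_sin_sq (Real.pi * x)
  have hx' : (Real.sin (Real.pi * x) : ℂ) ≠ 0 := by exact_mod_cast hx
  rw [h2, cotWeight, Complex.ofReal_div, Complex.ofReal_div]
  generalize (Real.cos (Real.pi * x) : ℂ) = c at *
  generalize (Real.sin (Real.pi * x) : ℂ) = s at *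
  have hI := Complex.I_sq
  have e : 1 / 2 + c / s / ((2 : ℝ) : ℂ) * Complex.I = (s + c * Complex.I) / (2 * s) := by
    push_cast
    field_simp
  rw [e, div_mul_eq_mul_div, div_eq_one_iff_eq (mul_ne_zero two_ne_zero hx')]
  linear_combination (s - c * Complex.I) * h1
    + (-2 * c ^ 2 * s - c * s ^ 2 * Complex.I - s ^ 3) * hI

/-- Jordan's inequality on [0, 1/2], reflected about 1/2. -/
lemma two_mul_le_sin_pi_mul {x d : ℝ} (hd : 0 ≤ d) (h1 : d ≤ x) (h2 : x ≤ 1 - d) :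
    2 * d ≤ Real.sin (Real.pi * x) := by
  have hpi := Real.pi_pos
  rcases le_total x (1 / 2) with h | h
  · have := Real.mul_le_sin (x := Real.pi * x) (by nlinarith) (by nlinarith)
    have h3 : 2 / Real.pi * (Real.pi * x) = 2 * x := by field_simp
    linarith
  · have := Real.mul_le_sin (x := Real.pi - Real.pi * x) (by nlinarith) (by nlinarith)
    have h3 : 2 / Real.pi * (Real.pi - Real.pi * x) = 2 * (1 - x) := by field_simp
    rw [Real.sin_pi_sub] at this
    linarith

lemma abs_cot_le {x d : ℝ} (hd : 0 < d) (h1 : d ≤ x) (h2 : x ≤ 1 - d) :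
    |Real.cos (Real.pi * x) / Real.sin (Real.pi * x)| ≤ 1 / (2 * d) := by
  have h := two_mul_le_sin_pi_mul hd.le h1 h2
  rw [abs_div, abs_of_pos (a := Real.sin _) (by linarith)]
  exact div_le_div₀ zero_le_one (Real.abs_cos_le_one _) (by linarith) h

lemma cot_pi_mul_le {x y : ℝ} (hx : 0 < x) (hxy : x ≤ y) (hy : y < 1) :
    Real.cos (Real.pi * y) / Real.sin (Real.pi * y) ≤
      Real.cos (Real.pi * x) / Real.sin (Real.pi * x) := by
  have hpi := Real.pi_pos
  have sx : 0 < Real.sin (Real.pi * x) :=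
    Real.sin_pos_of_pos_of_lt_pi (by positivity) (by nlinarith)
  have sy : 0 < Real.sin (Real.pi * y) :=
    Real.sin_pos_of_pos_of_lt_pi (by nlinarith) (by nlinarith)
  have h := Real.sin_nonneg_of_nonneg_of_le_pi (x := Real.pi * y - Real.pi * x)
    (by nlinarith) (by nlinarith)
  rw [Real.sin_sub] at h
  rw [div_le_div_iff₀ sy sx]
  linarith

lemma norm_cotWeight_le {x d : ℝ} (hd : 0 < d) (h1 : d ≤ x) (h2 : x ≤ 1 - d) :
    ‖cotWeight x‖ ≤ 1 / 2 + 1 / (4 * d) := by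
  unfold cotWeight
  refine (norm_add_le _ _).trans (add_le_add (by norm_num) ?_)
  rw [norm_mul, Complex.norm_I, mul_one, Complex.norm_real, Real.norm_eq_abs, abs_div, abs_two]
  have := abs_cot_le hd h1 h2
  calc _ ≤ 1 / (2 * d) / 2 := by gcongr
    _ = _ := by field_simp; norm_num

/-- The Kusmin–Landau inequality, with first differences in `[d, 1 - d]`. -/
theorem kusmin_landau {f : ℕ → ℝ} {a b : ℕ} {d : ℝ} (hd : 0 < d)
    (hl : ∀ n, a ≤ n → n < b → d ≤ f (n + 1) - f n)
    (hu : ∀ n, a ≤ n → n < b → f (n + 1) - f n ≤ 1 - d)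
    (hanti : ∀ n, a ≤ n → n + 1 < b → f (n + 2) - f (n + 1) ≤ f (n + 1) - f n) :
    ‖∑ n ∈ Finset.Ico a b, unitExp (f n)‖ ≤ 2 / d := by
  rcases le_or_gt b a with hab | hab
  · rw [Finset.Ico_eq_empty (by omega)]
    simp only [Finset.sum_empty, norm_zero]
    positivity
  have hd1 : d ≤ 1 / 2 := by linarith [hl a le_rfl hab, hu a le_rfl hab]
  let h : ℕ → ℝ := fun n =>
    Real.cos (Real.pi * (f (n + 1) - f n)) / Real.sin (Real.pi * (f (n + 1) - f n)) / 2
  let w : ℕ → ℂ := fun n => cotWeight (f (n + 1) - f n)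
  have hw : ∀ n, a ≤ n → n < b → unitExp (f n) + w n * unitExp (f (n + 1)) = w n * unitExp (f n) := by
    intro n h1 h2
    have hs := two_mul_le_sin_pi_mul hd.le (hl n h1 h2) (hu n h1 h2)
    have hm := cotWeight_mul (x := f (n + 1) - f n) (by linarith)
    have he : unitExp (f (n + 1)) = unitExp (f n) * unitExp (f (n + 1) - f n) := by
      rw [← unitExp_add]; congr 1; ring
    rw [he]
    linear_combination (-unitExp (f n)) * hm
  -- Summation by parts. The weights have constant real part, and their imaginary parts increase
  -- because cot decreases, so their total variation telescopes to `h (a + m) - h a`.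
  have key : ∀ m, a + m < b →
      ‖∑ n ∈ Finset.Ico a (a + m + 1), unitExp (f n) + w (a + m) * unitExp (f (a + m + 1))‖ ≤
        ‖w a‖ + (h (a + m) - h a) := by
    intro m
    induction m with
    | zero =>
      intro hm
      simp only [add_zero, Nat.Ico_succ_singleton, Finset.sum_singleton, sub_self]
      rw [hw a le_rfl hab, norm_mul, norm_unitExp, mul_one]
    | succ m ih =>
      intro hm
      have ih := ih (by omega)
      rw [← add_assoc, Finset.sum_Ico_succ_top (by omega), add_assoc,
        hw (a + m + 1) (by omega) (by omega)]
      have e1 : ∑ n ∈ Finset.Ico a (a + m + 1), unitExp (f n) + w (a + m + 1) * unitExp (f (a + m + 1))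
          = (∑ n ∈ Finset.Ico a (a + m + 1), unitExp (f n) + w (a + m) * unitExp (f (a + m + 1)))
            + (w (a + m + 1) - w (a + m)) * unitExp (f (a + m + 1)) := by ring
      rw [e1]
      refine (norm_add_le _ _).trans ?_
      have e2 : w (a + m + 1) - w (a + m) = ((h (a + m + 1) - h (a + m) : ℝ) : ℂ) * Complex.I := by
        simp only [w, h, cotWeight]
        push_cast
        ring
      have e3 : h (a + m) ≤ h (a + m + 1) := by
        simp only [h]
        have := cot_pi_mul_le (x := f (a + m + 2) - f (a + m + 1)) (y := f (a + m + 1) - f (a + m))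
          (by linarith [hl (a + m + 1) (by omega) hm]) (hanti (a + m) (by omega) hm)
          (by linarith [hu (a + m) (by omega) (by omega)])
        linarith
      rw [norm_mul, norm_unitExp, mul_one, e2, norm_mul, Complex.norm_I, mul_one,
        Complex.norm_real, Real.norm_eq_abs, abs_of_nonneg (by linarith)]
      linarith
  have k1 := key (b - 1 - a) (by omega)
  have e : a + (b - 1 - a) = b - 1 := by omega
  have e' : b - 1 + 1 = b := by omega
  rw [e, e'] at k1
  have ha := norm_cotWeight_le hd (hl a le_rfl hab) (hu a le_rfl hab)
  have hb := norm_cotWeight_le hd (hl (b - 1) (by omega) (by omega)) (hu (b - 1) (by omega) (by omega))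
  have ca := abs_le.1 (abs_cot_le hd (hl a le_rfl hab) (hu a le_rfl hab))
  have cb := abs_le.1 (abs_cot_le hd (hl (b - 1) (by omega) (by omega)) (hu (b - 1) (by omega) (by omega)))
  have tri : ‖∑ n ∈ Finset.Ico a b, unitExp (f n)‖ ≤
      ‖∑ n ∈ Finset.Ico a b, unitExp (f n) + w (b - 1) * unitExp (f b)‖ + ‖w (b - 1)‖ := by
    have := norm_sub_le (∑ n ∈ Finset.Ico a b, unitExp (f n) + w (b - 1) * unitExp (f b))
      (w (b - 1) * unitExp (f b))
    rwa [add_sub_cancel_right, norm_mul, norm_unitExp, mul_one] at this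
  -- The two boundary weights give 1 + 1/(2d) and the variation gives 1/(2d); as d ≤ 1/2, the total
  -- 1 + 1/d is below 2/d.
  have s1 : 1 / (4 * d) = (1 / d) / 4 := by field_simp
  have s2 : 1 / (2 * d) = (1 / d) / 2 := by field_simp
  have s3 : 2 / d = 2 * (1 / d) := by ring
  have s4 : 2 ≤ 1 / d := by rw [le_div_iff₀ hd]; linarith
  rw [s1] at ha hb
  rw [s2] at ca cb
  rw [s3]
  simp only [w, h] at *
  linarith [ca.1, ca.2, cb.1, cb.2]

/-! ### The discrete second derivative test. -/

/-- A predicate on `[a, b)` that is closed downwards holds exactly on an initial segment. -/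
lemma exists_split_of_downward {P : ℕ → Prop} {a b : ℕ} (hab : a ≤ b)
    (hP : ∀ n, a ≤ n → n + 1 < b → P (n + 1) → P n) :
    ∃ c, a ≤ c ∧ c ≤ b ∧ (∀ n, a ≤ n → n < c → P n) ∧ ∀ n, c ≤ n → n < b → ¬ P n := by
  induction b, hab using Nat.le_induction with
  | base => exact ⟨a, le_rfl, le_rfl, fun n _ _ => by omega, fun n _ _ => by omega⟩
  | succ b hab ih =>
    obtain ⟨c, h1, h2, h3, h4⟩ := ih (fun n h1 h2 => hP n h1 (by omega))
    by_cases hb : P b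
    · refine ⟨b + 1, by omega, le_rfl, fun n k1 k2 => ?_, fun n _ _ => by omega⟩
      have hcb : c = b := by
        by_contra hne
        have hbc : b - 1 + 1 = b := by omega
        exact h4 (b - 1) (by omega) (by omega) (hP (b - 1) (by omega) (by omega) (hbc ▸ hb))
      rcases Nat.lt_succ_iff_lt_or_eq.1 k2 with h | h
      · exact h3 n k1 (by omega)
      · exact h ▸ hb
    · refine ⟨c, h1, by omega, h3, fun n k1 k2 => ?_⟩
      rcases Nat.lt_succ_iff_lt_or_eq.1 k2 with h | h
      · exact h4 n k1 h
      · exact h ▸ hb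

/-- A sequence with decrements at least `l` spends few steps in an interval of length `r`. -/
lemma card_le_of_decrement {g : ℕ → ℝ} {a b : ℕ} {l r : ℝ} (hl : 0 < l) (hr : 0 ≤ r)
    (hdec : ∀ n, a ≤ n → n + 1 < b → l ≤ g n - g (n + 1))
    (hrange : ∀ m n, a ≤ m → m < b → a ≤ n → n < b → g m - g n ≤ r) :
    ((b - a : ℕ) : ℝ) ≤ r / l + 1 := by
  rcases le_or_gt b a with hab | hab
  · rw [Nat.sub_eq_zero_of_le hab]
    simp only [Nat.cast_zero]
    positivity
  have key : ∀ m, a + m < b → m * l ≤ g a - g (a + m) := by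
    intro m
    induction m with
    | zero => simp
    | succ m ih =>
      intro hm
      have h1 := ih (by omega)
      have h2 := hdec (a + m) (by omega) hm
      push_cast
      rw [← add_assoc]
      linarith
  have h1 := key (b - a - 1) (by omega)
  have h2 := hrange a (a + (b - a - 1)) le_rfl hab (by omega) (by omega)
  have h3 : ((b - a : ℕ) : ℝ) = ((b - a - 1 : ℕ) : ℝ) + 1 := by
    exact_mod_cast (by omega : b - a = b - a - 1 + 1)
  rw [h3, add_le_add_iff_right, le_div_iff₀ hl]
  linarith

lemma norm_sum_unitExp_le_card (f : ℕ → ℝ) (a b : ℕ) :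
    ‖∑ n ∈ Finset.Ico a b, unitExp (f n)‖ ≤ ((b - a : ℕ) : ℝ) := by
  refine (norm_sum_le _ _).trans ?_
  simp [norm_unitExp]

/-- The second derivative test on a stretch where the first difference stays in `[0, 1)`. -/
lemma norm_sum_unitExp_le_of_mem_unit {f : ℕ → ℝ} {a b : ℕ} {d : ℝ} (hd : 0 < d) (hd1 : d ≤ 1)
    (h0 : ∀ n, a ≤ n → n < b → 0 ≤ f (n + 1) - f n)
    (h1 : ∀ n, a ≤ n → n < b → f (n + 1) - f n < 1)
    (hdec : ∀ n, a ≤ n → n + 1 < b → d ^ 2 ≤ (f (n + 1) - f n) - (f (n + 2) - f (n + 1))) :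
    ‖∑ n ∈ Finset.Ico a b, unitExp (f n)‖ ≤ 6 / d := by
  rcases le_or_gt b a with hab | hab
  · rw [Finset.Ico_eq_empty (by omega)]
    simp only [Finset.sum_empty, norm_zero]
    positivity
  have hd2 : 0 < d ^ 2 := by positivity
  -- Slopes decrease, so the range splits into slopes above 1 - d, in [d, 1 - d], and below d. The
  -- outer pieces have at most d/d² + 1 ≤ 2/d terms each, and Kusmin–Landau bounds the middle one by
  -- 2/d.
  obtain ⟨c, ac, cb, hc1, hc2⟩ := exists_split_of_downward (P := fun n => 1 - d < f (n + 1) - f n)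
    hab.le (fun n k1 k2 k3 => by
      have := hdec n k1 k2
      rw [add_assoc] at k3
      norm_num at k3
      linarith)
  obtain ⟨e, ce, eb, he1, he2⟩ := exists_split_of_downward (P := fun n => d ≤ f (n + 1) - f n)
    cb (fun n k1 k2 k3 => by
      have := hdec n (by omega) k2
      rw [add_assoc] at k3
      norm_num at k3
      linarith)
  have A := card_le_of_decrement (g := fun n => f (n + 1) - f n) (a := a) (b := c) hd2 hd.le
    (fun n k1 k2 => hdec n k1 (by omega))
    (fun m n k1 k2 k3 k4 => by linarith [h1 m k1 (by omega), hc1 n k3 k4])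
  have B := card_le_of_decrement (g := fun n => f (n + 1) - f n) (a := e) (b := b) hd2 hd.le
    (fun n k1 k2 => hdec n (by omega) k2)
    (fun m n k1 k2 k3 k4 => by linarith [h0 n (by omega) k4, not_le.1 (he2 m k1 k2)])
  have C := kusmin_landau (f := f) (a := c) (b := e) hd he1
    (fun n k1 k2 => not_lt.1 (hc2 n k1 (by omega)))
    (fun n k1 k2 => by linarith [hdec n (by omega) (by omega)])
  have A' := norm_sum_unitExp_le_card f a c
  have B' := norm_sum_unitExp_le_card f e b
  rw [← Finset.sum_Ico_consecutive _ ac cb, ← Finset.sum_Ico_consecutive _ ce eb]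
  have t1 := norm_add_le (∑ n ∈ Finset.Ico c e, unitExp (f n)) (∑ n ∈ Finset.Ico e b, unitExp (f n))
  have t2 := norm_add_le (∑ n ∈ Finset.Ico a c, unitExp (f n))
    (∑ n ∈ Finset.Ico c e, unitExp (f n) + ∑ n ∈ Finset.Ico e b, unitExp (f n))
  have s1 : d / d ^ 2 = 1 / d := by field_simp
  have s2 : 1 ≤ 1 / d := by rw [le_div_iff₀ hd]; linarith
  have s3 : 6 / d = 6 * (1 / d) := by ring
  have s4 : 2 / d = 2 * (1 / d) := by ring
  rw [s1] at A B
  rw [s4] at C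
  rw [s3]
  linarith

/-- The second derivative test on a stretch where the first difference stays in `[k, k + 1)`. -/
theorem norm_sum_unitExp_le_of_mem_block {f : ℕ → ℝ} {a b : ℕ} {d : ℝ} (k : ℕ) (hd : 0 < d)
    (hd1 : d ≤ 1)
    (h0 : ∀ n, a ≤ n → n < b → k ≤ f (n + 1) - f n)
    (h1 : ∀ n, a ≤ n → n < b → f (n + 1) - f n < k + 1)
    (hdec : ∀ n, a ≤ n → n + 1 < b → d ^ 2 ≤ (f (n + 1) - f n) - (f (n + 2) - f (n + 1))) :
    ‖∑ n ∈ Finset.Ico a b, unitExp (f n)‖ ≤ 6 / d := by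
  -- Subtracting the integer k n leaves e(f n) unchanged and lowers the slope by k.
  have h := norm_sum_unitExp_le_of_mem_unit (f := fun n => f n - k * n) (a := a) (b := b) hd hd1
    (fun n k1 k2 => by push_cast; linarith [h0 n k1 k2])
    (fun n k1 k2 => by push_cast; linarith [h1 n k1 k2])
    (fun n k1 k2 => by push_cast; linarith [hdec n k1 k2])
  refine (congrArg norm (Finset.sum_congr rfl fun n _ => ?_)).trans_le h
  have e : f n = (f n - k * n) + ((k * n : ℤ) : ℝ) := by push_cast; ring
  conv_lhs => rw [e, unitExp_add, unitExp_intCast, mul_one]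

/-! ### Partial summation and power sums. -/

/-- Abel's inequality for a nonnegative antitone weight. -/
theorem norm_sum_smul_le_of_antitone {E : Type*} [NormedAddCommGroup E] [NormedSpace ℝ E]
    {w : ℕ → ℝ} {z : ℕ → E} {a b : ℕ} {C : ℝ} (hab : a < b)
    (hw0 : ∀ n, a ≤ n → n < b → 0 ≤ w n)
    (hw : ∀ n, a ≤ n → n + 1 < b → w (n + 1) ≤ w n)
    (hz : ∀ c, a ≤ c → c ≤ b → ‖∑ n ∈ Finset.Ico a c, z n‖ ≤ C) :
    ‖∑ n ∈ Finset.Ico a b, w n • z n‖ ≤ w a * C := by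
  have key : ∀ m, a + m < b →
      ‖∑ n ∈ Finset.Ico a (a + m + 1), w n • z n - w (a + m) • ∑ n ∈ Finset.Ico a (a + m + 1), z n‖ ≤
        (w a - w (a + m)) * C := by
    intro m
    induction m with
    | zero => simp
    | succ m ih =>
      intro hm
      have ih := ih (by omega)
      have hz' := hz (a + m + 1) (by omega) (by omega)
      have hw' := hw (a + m) (by omega) hm
      rw [← add_assoc, Finset.sum_Ico_succ_top (b := a + m + 1) (by omega),
        Finset.sum_Ico_succ_top (b := a + m + 1) (by omega)]
      have e : ∑ n ∈ Finset.Ico a (a + m + 1), w n • z n + w (a + m + 1) • z (a + m + 1)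
            - w (a + m + 1) • (∑ n ∈ Finset.Ico a (a + m + 1), z n + z (a + m + 1))
          = (∑ n ∈ Finset.Ico a (a + m + 1), w n • z n
              - w (a + m) • ∑ n ∈ Finset.Ico a (a + m + 1), z n)
            + (w (a + m) - w (a + m + 1)) • ∑ n ∈ Finset.Ico a (a + m + 1), z n := by
        rw [smul_add, sub_smul]
        abel
      rw [e]
      refine (norm_add_le _ _).trans ?_
      rw [norm_smul, Real.norm_eq_abs, abs_of_nonneg (by linarith)]
      have := mul_le_mul_of_nonneg_left hz' (sub_nonneg.2 hw')
      linarith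
  have k1 := key (b - 1 - a) (by omega)
  have e : a + (b - 1 - a) = b - 1 := by omega
  have e' : b - 1 + 1 = b := by omega
  rw [e, e'] at k1
  have hwb := hw0 (b - 1) (by omega) (by omega)
  have t := norm_le_norm_sub_add (∑ n ∈ Finset.Ico a b, w n • z n)
    (w (b - 1) • ∑ n ∈ Finset.Ico a b, z n)
  rw [norm_smul, Real.norm_eq_abs, abs_of_nonneg hwb] at t
  have := mul_le_mul_of_nonneg_left (hz b hab.le le_rfl) hwb
  linarith

/-- Induction on K: Bernoulli's inequality for (1 - 1/(K+1))^s gives K^s ≤ (K+1)^s - s (K+1)^(s-1).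
-/
lemma sum_range_rpow_sub_one_le {s : ℝ} (hs : 0 < s) (hs1 : s ≤ 1) (K : ℕ) :
    ∑ k ∈ Finset.range K, ((k : ℝ) + 1) ^ (s - 1) ≤ (K : ℝ) ^ s / s := by
  induction K with
  | zero => simp [Real.zero_rpow hs.ne']
  | succ K ih =>
    rw [Finset.sum_range_succ]
    have hK : (0 : ℝ) < (K : ℝ) + 1 := by positivity
    have hb := rpow_one_add_le_one_add_mul_self (s := -1 / ((K : ℝ) + 1))
      (by rw [le_div_iff₀ hK]; linarith [(Nat.cast_nonneg K : (0 : ℝ) ≤ K)]) hs.le hs1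
    have e1 : 1 + -1 / ((K : ℝ) + 1) = K / ((K : ℝ) + 1) := by field_simp; ring
    rw [e1, Real.div_rpow (Nat.cast_nonneg K) hK.le, div_le_iff₀ (by positivity)] at hb
    have e2 : (1 + s * (-1 / ((K : ℝ) + 1))) * ((K : ℝ) + 1) ^ s
        = ((K : ℝ) + 1) ^ s - s * ((K : ℝ) + 1) ^ (s - 1) := by
      rw [Real.rpow_sub_one hK.ne']
      ring
    rw [e2] at hb
    push_cast
    rw [le_div_iff₀ hs] at ih ⊢
    linarith

/-! ### The phase T log n and its weighted exponential sums. -/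

section LogPhase

variable {T : ℝ} {n : ℕ}

lemma mul_log_succ_sub_le (hT : 0 ≤ T) (hn : 0 < n) :
    T * Real.log ((n + 1 : ℕ) : ℝ) - T * Real.log n ≤ T / n := by
  have hn' : (0 : ℝ) < n := by exact_mod_cast hn
  rw [← mul_sub, ← Real.log_div (by positivity) hn'.ne', div_eq_mul_inv]
  refine mul_le_mul_of_nonneg_left ?_ hT
  refine (Real.log_le_sub_one_of_pos (by positivity)).trans_eq ?_
  push_cast
  field_simp
  ring

lemma le_mul_log_succ_sub (hT : 0 ≤ T) (hn : 0 < n) :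
    T / (n + 1) ≤ T * Real.log ((n + 1 : ℕ) : ℝ) - T * Real.log n := by
  have hn' : (0 : ℝ) < n := by exact_mod_cast hn
  rw [← mul_sub, ← Real.log_div (by positivity) hn'.ne', div_eq_mul_inv]
  refine mul_le_mul_of_nonneg_left ?_ hT
  refine le_trans (le_of_eq ?_) (Real.one_sub_inv_le_log_of_pos (by positivity))
  push_cast
  field_simp
  ring

/-- Apply log y ≥ 1 - 1/y to y = (n+1)²/(n(n+2)), where 1 - 1/y = 1/(n+1)². -/
lemma le_mul_log_second_difference (hT : 0 ≤ T) (hn : 0 < n) :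
    T / (n + 1) ^ 2 ≤ (T * Real.log ((n + 1 : ℕ) : ℝ) - T * Real.log n)
      - (T * Real.log ((n + 2 : ℕ) : ℝ) - T * Real.log ((n + 1 : ℕ) : ℝ)) := by
  have hn' : (0 : ℝ) < n := by exact_mod_cast hn
  have h1 : (0 : ℝ) < (n : ℝ) + 1 := by positivity
  have h2 : (0 : ℝ) < (n : ℝ) + 2 := by positivity
  have e : (T * Real.log ((n + 1 : ℕ) : ℝ) - T * Real.log n)
      - (T * Real.log ((n + 2 : ℕ) : ℝ) - T * Real.log ((n + 1 : ℕ) : ℝ))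
      = T * Real.log (((n : ℝ) + 1) ^ 2 / (n * (n + 2))) := by
    rw [Real.log_div (by positivity) (by positivity), Real.log_mul hn'.ne' h2.ne', Real.log_pow]
    push_cast
    ring
  rw [e, div_eq_mul_inv]
  refine mul_le_mul_of_nonneg_left ?_ hT
  refine le_trans (le_of_eq ?_) (Real.one_sub_inv_le_log_of_pos (by positivity))
  field_simp
  ring

end LogPhase

/-- The part of the weighted sum where the first difference of the phase lies in `[k, k + 1)`. -/
lemma norm_sum_rpow_smul_unitExp_block_le {s T : ℝ} (hs : 0 < s) (hT : 1 ≤ T) {p q : ℕ}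
    (hp : √T ≤ p) (hq : (q : ℝ) ≤ 2 * T + 1) (k : ℕ) :
    ‖∑ n ∈ Finset.Ico p q with ⌊T * Real.log ((n + 1 : ℕ) : ℝ) - T * Real.log n⌋₊ = k,
      ((n : ℝ) ^ (-s)) • unitExp (T * Real.log n)‖ ≤
      24 * √T * (2 / T) ^ s * ((k : ℝ) + 1) ^ (s - 1) := by
  have hT0 : 0 < T := by linarith
  have hsq : 0 < √T := Real.sqrt_pos.2 hT0
  have hss : √T * √T = T := Real.mul_self_sqrt hT0.le
  have hp0 : 0 < p := by exact_mod_cast hsq.trans_le hp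
  have hk : (0 : ℝ) < (k : ℝ) + 1 := by positivity
  set f : ℕ → ℝ := fun n => T * Real.log n with hf
  have hg0 : ∀ n, p ≤ n → 0 ≤ f (n + 1) - f n := fun n h =>
    le_trans (by positivity) (le_mul_log_succ_sub hT0.le (by omega : 0 < n))
  have hdec : ∀ n, p ≤ n → f (n + 2) - f (n + 1) ≤ f (n + 1) - f n := fun n h =>
    sub_nonneg.1 (le_trans (by positivity) (le_mul_log_second_difference hT0.le (by omega : 0 < n)))
  rcases le_total q p with hpq | hpq
  · rw [Finset.Ico_eq_empty (by omega)]
    simp only [Finset.filter_empty, Finset.sum_empty, norm_zero]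
    positivity
  obtain ⟨c, pc, cq, hc1, hc2⟩ := exists_split_of_downward
    (P := fun n => (k : ℝ) + 1 ≤ f (n + 1) - f n) hpq
    (fun n k1 _ k3 => k3.trans (hdec n k1))
  obtain ⟨e, ce, eq, he1, he2⟩ := exists_split_of_downward
    (P := fun n => (k : ℝ) ≤ f (n + 1) - f n) cq
    (fun n k1 _ k3 => k3.trans (hdec n (by omega)))
  have hfilter : (Finset.Ico p q).filter
      (fun n => ⌊T * Real.log ((n + 1 : ℕ) : ℝ) - T * Real.log n⌋₊ = k) = Finset.Ico c e := by
    ext n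
    simp only [Finset.mem_filter, Finset.mem_Ico]
    constructor
    · rintro ⟨⟨h1, h2⟩, h3⟩
      rw [Nat.floor_eq_iff (hg0 n h1)] at h3
      constructor
      · by_contra h
        exact absurd (hc1 n h1 (by omega)) (not_le.2 h3.2)
      · by_contra h
        exact he2 n (by omega) h2 h3.1
    · rintro ⟨h1, h2⟩
      refine ⟨⟨by omega, by omega⟩, ?_⟩
      rw [Nat.floor_eq_iff (hg0 n (by omega))]
      exact ⟨he1 n h1 h2, not_le.1 (hc2 n h1 (by omega))⟩
  rw [hfilter]
  rcases le_or_gt e c with hec | hec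
  · rw [Finset.Ico_eq_empty (by omega)]
    simp only [Finset.sum_empty, norm_zero]
    positivity
  -- For k ≥ 1 this is k ≤ T/n with k + 1 ≤ 2k; for k = 0 it comes from the bound on q.
  have hupper : ∀ n, c ≤ n → n < e → (n : ℝ) * (k + 1) ≤ 2 * T := by
    intro n h1 h2
    have hn : (1 : ℝ) ≤ n := by exact_mod_cast (by omega : 1 ≤ n)
    rcases Nat.eq_zero_or_pos k with h | h
    · have : ((n + 1 : ℕ) : ℝ) ≤ q := by exact_mod_cast (by omega : n + 1 ≤ q)
      push_cast at this
      rw [h, Nat.cast_zero, zero_add, mul_one]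
      linarith
    · have hk1 : (1 : ℝ) ≤ k := by exact_mod_cast h
      have := (he1 n h1 h2).trans (mul_log_succ_sub_le hT0.le (by omega : 0 < n))
      rw [le_div_iff₀ (by linarith)] at this
      nlinarith
  have hc0 : (1 : ℝ) ≤ c := by exact_mod_cast (by omega : 1 ≤ c)
  -- The test parameter is d = (k+1)/(4√T): d² = (k+1)²/(16T) is at most T/(n+1)², since (k+1)(n+1)
  -- ≤ 4T. The condition d ≤ 1 is where √T ≤ p enters.
  have hd1 : ((k : ℝ) + 1) / (4 * √T) ≤ 1 := by
    rw [div_le_one (by positivity)]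
    have h1 := hupper c le_rfl hec
    have h2 : √T ≤ c := hp.trans (by exact_mod_cast pc)
    nlinarith
  have hsum : ∀ m, c ≤ m → m ≤ e →
      ‖∑ n ∈ Finset.Ico c m, unitExp (f n)‖ ≤ 6 / (((k : ℝ) + 1) / (4 * √T)) := by
    intro m _ hm
    refine norm_sum_unitExp_le_of_mem_block k (by positivity) hd1
      (fun n h1 h2 => he1 n h1 (by omega)) (fun n h1 h2 => not_le.1 (hc2 n h1 (by omega))) ?_
    intro n h1 h2
    refine le_trans ?_ (le_mul_log_second_difference hT0.le (by omega : 0 < n))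
    have h3 := hupper n h1 (by omega)
    have hn : (1 : ℝ) ≤ n := by exact_mod_cast (by omega : 1 ≤ n)
    have h4 : ((k : ℝ) + 1) * (n + 1) ≤ 4 * T := by nlinarith
    have e1 : (((k : ℝ) + 1) / (4 * √T)) ^ 2 = ((k : ℝ) + 1) ^ 2 / (16 * T) := by
      rw [div_pow, mul_pow, Real.sq_sqrt hT0.le]; norm_num
    rw [e1, div_le_div_iff₀ (by positivity) (by positivity), ← mul_pow]
    have h5 : 0 ≤ ((k : ℝ) + 1) * (n + 1) := by positivity
    nlinarith
  have habel := norm_sum_smul_le_of_antitone (w := fun n : ℕ => (n : ℝ) ^ (-s))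
    (z := fun n => unitExp (f n)) hec (fun n _ _ => by positivity)
    (fun n h1 _ => Real.rpow_le_rpow_of_nonpos (by exact_mod_cast (by omega : 0 < n))
      (by push_cast; linarith) (by linarith)) hsum
  refine habel.trans ?_
  have hTc : T / (2 * (k + 1)) ≤ c := by
    have h1 := (le_mul_log_succ_sub hT0.le (by omega : 0 < c)).trans_lt
      (not_le.1 (hc2 c le_rfl (by omega)))
    rw [div_lt_iff₀ (by positivity)] at h1
    rw [div_le_iff₀ (by positivity)]
    nlinarith
  have hw : (c : ℝ) ^ (-s) ≤ (2 / T) ^ s * ((k : ℝ) + 1) ^ s := by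
    refine (Real.rpow_le_rpow_of_nonpos (by positivity) hTc (by linarith)).trans_eq ?_
    rw [Real.rpow_neg (by positivity), ← Real.inv_rpow (by positivity),
      ← Real.mul_rpow (by positivity) hk.le]
    congr 1
    field_simp
  have e2 : 24 * √T * (2 / T) ^ s * ((k : ℝ) + 1) ^ (s - 1)
      = (2 / T) ^ s * ((k : ℝ) + 1) ^ s * (6 / (((k : ℝ) + 1) / (4 * √T))) := by
    rw [Real.rpow_sub_one hk.ne']
    field_simp
    ring
  rw [e2]
  exact mul_le_mul_of_nonneg_right hw (by positivity)

/-- The bound `O(√T p ^ (-s))` for `∑ n ^ (-s + 2 π i T)` over `p ≤ n < q`, for `√T ≤ p`. -/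
theorem norm_sum_rpow_smul_unitExp_le_of_sqrt_le {s T : ℝ} (hs : 0 < s) (hs1 : s ≤ 1)
    (hT : 1 ≤ T) {p q : ℕ} (hp : √T ≤ p) (hq : (q : ℝ) ≤ 2 * T + 1) :
    ‖∑ n ∈ Finset.Ico p q, ((n : ℝ) ^ (-s)) • unitExp (T * Real.log n)‖ ≤
      144 / s * √T * (p : ℝ) ^ (-s) := by
  have hT0 : 0 < T := by linarith
  have hsq : 0 < √T := Real.sqrt_pos.2 hT0
  have hp0 : 0 < p := by exact_mod_cast hsq.trans_le hp
  have hp0' : (0 : ℝ) < p := by exact_mod_cast hp0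
  rcases le_or_gt q p with hpq | hpq
  · rw [Finset.Ico_eq_empty (by omega)]
    simp only [Finset.sum_empty, norm_zero]
    positivity
  -- No first difference exceeds T/p, so only blocks with k < K occur.
  set K : ℕ := ⌊T / p⌋₊ + 1 with hK
  have hmaps : ∀ n ∈ Finset.Ico p q,
      ⌊T * Real.log ((n + 1 : ℕ) : ℝ) - T * Real.log n⌋₊ ∈ Finset.range K := by
    intro n hn
    rw [Finset.mem_Ico] at hn
    rw [Finset.mem_range, hK, Nat.lt_succ_iff]
    refine Nat.floor_le_floor ((mul_log_succ_sub_le hT0.le (by omega)).trans ?_)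
    exact div_le_div_of_nonneg_left hT0.le hp0' (by exact_mod_cast hn.1)
  rw [← Finset.sum_fiberwise_of_maps_to hmaps]
  refine (norm_sum_le_of_le _ fun k _ =>
    norm_sum_rpow_smul_unitExp_block_le hs hT hp hq k).trans ?_
  rw [← Finset.mul_sum]
  have hKle : (K : ℝ) ≤ 3 * T / p := by
    have h1 : ((p + 1 : ℕ) : ℝ) ≤ q := by exact_mod_cast hpq
    push_cast at h1
    have h2 : (⌊T / p⌋₊ : ℝ) ≤ T / p := Nat.floor_le (by positivity)
    have h3 : 1 ≤ 2 * T / p := by rw [le_div_iff₀ hp0']; linarith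
    have h4 : 3 * T / p = T / p + 2 * T / p := by ring
    rw [h4, hK]
    push_cast
    linarith
  have hKs : (K : ℝ) ^ s ≤ (3 * T / p) ^ s := Real.rpow_le_rpow (by positivity) hKle hs.le
  have h6 : (2 / T) ^ s * (3 * T / p) ^ s ≤ 6 * (p : ℝ) ^ (-s) := by
    rw [← Real.mul_rpow (by positivity) (by positivity), Real.rpow_neg hp0'.le]
    have e : 2 / T * (3 * T / p) = 6 / p := by field_simp; norm_num
    rw [e, Real.div_rpow (by norm_num) hp0'.le, div_eq_mul_inv]
    refine mul_le_mul_of_nonneg_right ?_ (by positivity)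
    exact (Real.rpow_le_rpow_of_exponent_le (by norm_num) hs1).trans_eq (Real.rpow_one _)
  calc 24 * √T * (2 / T) ^ s * ∑ k ∈ Finset.range K, ((k : ℝ) + 1) ^ (s - 1)
      ≤ 24 * √T * (2 / T) ^ s * ((3 * T / p) ^ s / s) := by
        refine mul_le_mul_of_nonneg_left ?_ (by positivity)
        exact (sum_range_rpow_sub_one_le hs hs1 K).trans (div_le_div_of_nonneg_right hKs hs.le)
    _ = 24 * √T / s * ((2 / T) ^ s * (3 * T / p) ^ s) := by ring
    _ ≤ 24 * √T / s * (6 * (p : ℝ) ^ (-s)) := mul_le_mul_of_nonneg_left h6 (by positivity)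
    _ = _ := by ring

/-- The bound `O(√T p ^ (-s))` for `∑ n ^ (-s + 2 π i T)` over `p ≤ n < q`. -/
theorem norm_sum_rpow_smul_unitExp_le {s T : ℝ} (hs : 0 < s) (hs1 : s ≤ 1)
    (hT : 1 ≤ T) {p q : ℕ} (hp : 0 < p) (hq : (q : ℝ) ≤ 2 * T + 1) :
    ‖∑ n ∈ Finset.Ico p q, ((n : ℝ) ^ (-s)) • unitExp (T * Real.log n)‖ ≤
      (144 / s + 2) * √T * (p : ℝ) ^ (-s) := by
  have hT0 : 0 < T := by linarith
  have hsq : 1 ≤ √T := Real.one_le_sqrt.2 hT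
  have hp0 : (0 : ℝ) < p := by exact_mod_cast hp
  have hps : 0 ≤ √T * (p : ℝ) ^ (-s) := by positivity
  -- Below ⌈√T⌉ the trivial bound suffices: at most √T + 1 ≤ 2√T terms, each at most p^(-s).
  have htriv : ∀ r : ℕ, r ≤ ⌈√T⌉₊ →
      ‖∑ n ∈ Finset.Ico p r, ((n : ℝ) ^ (-s)) • unitExp (T * Real.log n)‖ ≤
        2 * √T * (p : ℝ) ^ (-s) := by
    intro r hr
    have h1 : ∀ n ∈ Finset.Ico p r,
        ‖((n : ℝ) ^ (-s)) • unitExp (T * Real.log n)‖ ≤ (p : ℝ) ^ (-s) := by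
      intro n hn
      rw [Finset.mem_Ico] at hn
      rw [norm_smul, norm_unitExp, mul_one, Real.norm_eq_abs, abs_of_nonneg (by positivity)]
      exact Real.rpow_le_rpow_of_nonpos hp0 (by exact_mod_cast hn.1) (by linarith)
    refine (norm_sum_le_of_le _ h1).trans ?_
    rw [Finset.sum_const, Nat.card_Ico, nsmul_eq_mul]
    refine mul_le_mul_of_nonneg_right ?_ (by positivity)
    have h2 : ((r - p : ℕ) : ℝ) ≤ ⌈√T⌉₊ := by exact_mod_cast (by omega : r - p ≤ ⌈√T⌉₊)
    have h3 := Nat.ceil_lt_add_one (Real.sqrt_nonneg T)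
    linarith
  have hsplit : (144 / s + 2) * √T * (p : ℝ) ^ (-s)
      = 144 / s * √T * (p : ℝ) ^ (-s) + 2 * √T * (p : ℝ) ^ (-s) := by ring
  have hnn : 0 ≤ 144 / s * √T * (p : ℝ) ^ (-s) := by positivity
  rw [hsplit]
  rcases le_total q ⌈√T⌉₊ with h | h
  · linarith [htriv q h]
  rcases le_total ⌈√T⌉₊ p with h' | h'
  · have := norm_sum_rpow_smul_unitExp_le_of_sqrt_le hs hs1 hT (Nat.ceil_le.1 h') hq
    linarith
  · rw [← Finset.sum_Ico_consecutive _ h' h]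
    have h1 := norm_sum_rpow_smul_unitExp_le_of_sqrt_le hs hs1 hT (Nat.le_ceil √T) hq
    have h2 : ((⌈√T⌉₊ : ℕ) : ℝ) ^ (-s) ≤ (p : ℝ) ^ (-s) :=
      Real.rpow_le_rpow_of_nonpos hp0 (by exact_mod_cast h') (by linarith)
    have h3 := mul_le_mul_of_nonneg_left h2 (by positivity : 0 ≤ 144 / s * √T)
    refine (norm_add_le _ _).trans ?_
    linarith [htriv _ le_rfl]

/-! ### Bounding the double sum. -/

lemma one_div_natCast_cpow_conj (σ t : ℝ) {n : ℕ} (hn : 0 < n) :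
    1 / (n : ℂ) ^ (starRingEnd ℂ ((σ : ℂ) + (t : ℂ) * Complex.I)) =
      ((n : ℝ) ^ (-σ)) • unitExp (t / (2 * Real.pi) * Real.log n) := by
  have hn' : (0 : ℝ) < n := by exact_mod_cast hn
  have hnc : (n : ℂ) ≠ 0 := by exact_mod_cast hn.ne'
  rw [one_div, ← Complex.cpow_neg, Complex.cpow_def_of_ne_zero hnc, Complex.real_smul,
    Real.rpow_def_of_pos hn', Complex.ofReal_exp, unitExp, ← Complex.exp_add,
    ← Complex.natCast_log]
  congr 1
  have hpi := Real.pi_ne_zero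
  have e : 2 * Real.pi * (t / (2 * Real.pi) * Real.log n) = t * Real.log n := by field_simp
  rw [e]
  simp only [map_add, map_mul, Complex.conj_ofReal, Complex.conj_I]
  push_cast
  ring

/-- The bound for the sum over `m₂`. -/
lemma norm_inner_sum_le {σ t x : ℝ} (hσ : 0 < σ) (hσ1 : σ ≤ 1) (ht : 2 * Real.pi ≤ t) (hx : 1 ≤ x)
    {m : ℕ} (hm : 0 < m) (hmT : m ≤ ⌊t / (2 * Real.pi)⌋₊) :
    ‖∑ m₂ ∈ Finset.Ioc ⌊(x - 1) * (m : ℝ)⌋₊ ⌊t / (2 * Real.pi)⌋₊,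
      1 / ((m : ℂ) ^ ((σ : ℂ) + (t : ℂ) * Complex.I) *
        ((m : ℂ) + (m₂ : ℂ)) ^ (starRingEnd ℂ ((σ : ℂ) + (t : ℂ) * Complex.I)))‖ ≤
      (144 / σ + 2) * √t * x ^ (-σ) * (m : ℝ) ^ (-(2 * σ)) := by
  have hpi := Real.pi_pos
  have hpi3 := Real.pi_gt_three
  have hm0 : (0 : ℝ) < m := by exact_mod_cast hm
  have ht0 : 0 < t := by linarith
  set T := t / (2 * Real.pi) with hT
  have hT1 : 1 ≤ T := by rwa [hT, le_div_iff₀ (by positivity), one_mul]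
  have hTt : T ≤ t := div_le_self ht0.le (by linarith)
  have hNT : (⌊T⌋₊ : ℝ) ≤ T := Nat.floor_le (by linarith)
  set L := ⌊(x - 1) * (m : ℝ)⌋₊ with hL
  have hsum : ∑ m₂ ∈ Finset.Ioc L ⌊T⌋₊,
      1 / ((m : ℂ) ^ ((σ : ℂ) + (t : ℂ) * Complex.I) *
        ((m : ℂ) + (m₂ : ℂ)) ^ (starRingEnd ℂ ((σ : ℂ) + (t : ℂ) * Complex.I)))
      = ((m : ℂ) ^ ((σ : ℂ) + (t : ℂ) * Complex.I))⁻¹ *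
        ∑ n ∈ Finset.Ico (L + 1 + m) (⌊T⌋₊ + 1 + m),
          ((n : ℝ) ^ (-σ)) • unitExp (T * Real.log n) := by
    rw [← Finset.sum_Ico_add' (fun n : ℕ => ((n : ℝ) ^ (-σ)) • unitExp (T * Real.log n)),
      Finset.mul_sum]
    have hset : Finset.Ioc L ⌊T⌋₊ = Finset.Ico (L + 1) (⌊T⌋₊ + 1) := by
      ext n
      simp only [Finset.mem_Ioc, Finset.mem_Ico]
      omega
    rw [hset]
    refine Finset.sum_congr rfl fun n _ => ?_
    rw [← one_div_natCast_cpow_conj σ t (by omega : 0 < n + m), one_div, mul_inv, one_div]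
    push_cast
    rw [add_comm (m : ℂ)]
  have hnorm : ‖((m : ℂ) ^ ((σ : ℂ) + (t : ℂ) * Complex.I))⁻¹‖ = (m : ℝ) ^ (-σ) := by
    rw [norm_inv, Complex.norm_natCast_cpow_of_pos hm, Real.rpow_neg hm0.le]
    simp
  rw [hsum, norm_mul, hnorm]
  have hb := norm_sum_rpow_smul_unitExp_le hσ hσ1 hT1 (p := L + 1 + m) (q := ⌊T⌋₊ + 1 + m)
    (by omega) (by
      have : (m : ℝ) ≤ ⌊T⌋₊ := by exact_mod_cast hmT
      push_cast
      linarith)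
  -- The first index exceeds (x - 1)m + m; this is where the cutoff on m₂ yields the saving x^(-σ).
  have hlow : x * m ≤ ((L + 1 + m : ℕ) : ℝ) := by
    have := Nat.lt_floor_add_one ((x - 1) * (m : ℝ))
    push_cast
    linarith
  have hrp : ((L + 1 + m : ℕ) : ℝ) ^ (-σ) ≤ x ^ (-σ) * (m : ℝ) ^ (-σ) := by
    rw [← Real.mul_rpow (by linarith) hm0.le]
    exact Real.rpow_le_rpow_of_nonpos (by positivity) hlow (by linarith)
  have hsq : √T ≤ √t := Real.sqrt_le_sqrt hTt
  calc (m : ℝ) ^ (-σ) * _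
      ≤ (m : ℝ) ^ (-σ) * ((144 / σ + 2) * √t * (x ^ (-σ) * (m : ℝ) ^ (-σ))) := by
        refine mul_le_mul_of_nonneg_left (hb.trans ?_) (by positivity)
        gcongr
    _ = (144 / σ + 2) * √t * x ^ (-σ) * ((m : ℝ) ^ (-σ) * (m : ℝ) ^ (-σ)) := by ring
    _ = _ := by
        rw [← Real.rpow_add hm0]
        ring_nf

/-- The majorant `t ^ (σ δ) ∑ m ^ (-2 σ)`, the sum over `1 ≤ m ≤ t ^ δ`. -/
noncomputable def doubleSumMajorant (σ t δ : ℝ) : ℝ :=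
  t ^ (σ * δ) * ∑ k ∈ Finset.range ⌊t ^ δ⌋₊, ((k : ℝ) + 1) ^ (-(2 * σ))

lemma norm_doubleSumS1_le {σ t δ : ℝ} (hσ : 0 < σ) (hσ1 : σ ≤ 1) (ht : 2 * Real.pi ≤ t)
    (hx : 2 ≤ t ^ (1 - δ)) :
    ‖doubleSumS1 σ t δ‖ ≤ (144 / σ + 2) * (t ^ (1 / 2 - σ) * doubleSumMajorant σ t δ) := by
  have hpi3 := Real.pi_gt_three
  have ht0 : 0 < t := by linarith
  set x := t ^ (1 - δ) with hxdef
  set N := ⌊t / (2 * Real.pi)⌋₊ with hN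
  set M := ⌊(N : ℝ) / (x - 1) - 1⌋₊ with hM
  have hNt : (N : ℝ) ≤ t / (2 * Real.pi) := Nat.floor_le (by positivity)
  have hMN : ∀ m ∈ Finset.Icc 1 M, m ≤ N := by
    intro m hm
    rw [Finset.mem_Icc] at hm
    have h1 : (m : ℝ) ≤ (N : ℝ) / (x - 1) - 1 := (Nat.le_floor_iff' (by omega)).1 hm.2
    have h2 : (N : ℝ) / (x - 1) ≤ N := div_le_self (Nat.cast_nonneg N) (by linarith)
    have h3 : (m : ℝ) ≤ N := by linarith
    exact_mod_cast h3
  have hMt : M ≤ ⌊t ^ δ⌋₊ := by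
    refine Nat.floor_le_floor ?_
    have h1 : t ^ δ = t / x := by
      rw [hxdef, Real.rpow_sub ht0, Real.rpow_one, div_div_cancel₀ ht0.ne']
    -- N ≤ t/2 and x/2 ≤ x - 1, the latter from x ≥ 2.
    have h2 : (N : ℝ) / (x - 1) ≤ t / x := by
      rw [div_le_div_iff₀ (by linarith) (by linarith)]
      have h3 : (N : ℝ) ≤ t / 2 :=
        hNt.trans (div_le_div_of_nonneg_left ht0.le (by norm_num) (by linarith))
      nlinarith
    linarith
  have hcoef : √t * x ^ (-σ) = t ^ (1 / 2 - σ) * t ^ (σ * δ) := by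
    rw [hxdef, Real.sqrt_eq_rpow, ← Real.rpow_mul ht0.le, ← Real.rpow_add ht0, ← Real.rpow_add ht0]
    ring_nf
  have hset : Finset.Icc 1 M = Finset.Ico (0 + 1) (M + 1) := by
    ext n
    simp only [Finset.mem_Icc, Finset.mem_Ico]
    omega
  have hsum : ∑ m ∈ Finset.Icc 1 M, (m : ℝ) ^ (-(2 * σ)) ≤
      ∑ k ∈ Finset.range ⌊t ^ δ⌋₊, ((k : ℝ) + 1) ^ (-(2 * σ)) := by
    rw [hset, ← Finset.sum_Ico_add' (fun n : ℕ => (n : ℝ) ^ (-(2 * σ))), ← Finset.range_eq_Ico]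
    push_cast
    exact Finset.sum_le_sum_of_subset_of_nonneg (Finset.range_mono hMt) fun _ _ _ => by positivity
  unfold doubleSumS1
  refine (norm_sum_le_of_le _ fun m hm => norm_inner_sum_le hσ hσ1 ht (by linarith)
    (Finset.mem_Icc.1 hm).1 (hMN m hm)).trans ?_
  rw [← Finset.mul_sum, mul_assoc _ (√t), hcoef, doubleSumMajorant]
  calc _ ≤ (144 / σ + 2) * (t ^ (1 / 2 - σ) * t ^ (σ * δ)) *
        ∑ k ∈ Finset.range ⌊t ^ δ⌋₊, ((k : ℝ) + 1) ^ (-(2 * σ)) :=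
        mul_le_mul_of_nonneg_left hsum (by positivity)
    _ = _ := by ring

/-! ### Growth of the majorant in the three ranges of σ. -/

open Filter Asymptotics

lemma doubleSumS1_isBigO {σ δ : ℝ} (hσ : 0 < σ) (hσ1 : σ ≤ 1) (hδ : δ < 1) :
    (fun t => doubleSumS1 σ t δ) =O[atTop]
      fun t : ℝ => t ^ (1 / 2 - σ) * doubleSumMajorant σ t δ := by
  refine IsBigO.of_bound (144 / σ + 2) ?_
  filter_upwards [eventually_ge_atTop (2 * Real.pi),
    (tendsto_rpow_atTop (by linarith : 0 < 1 - δ)).eventually_ge_atTop 2] with t ht hx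
  refine (norm_doubleSumS1_le hσ hσ1 ht hx).trans ?_
  gcongr
  exact le_abs_self _

lemma doubleSumMajorant_nonneg {t : ℝ} (ht : 0 ≤ t) (σ δ : ℝ) : 0 ≤ doubleSumMajorant σ t δ :=
  mul_nonneg (Real.rpow_nonneg ht _) (Finset.sum_nonneg fun _ _ => by positivity)

/-- The power sum is O(t^(δ(1-2σ))), and σδ + δ(1-2σ) = (1-σ)δ. -/
lemma doubleSumMajorant_isBigO_of_lt_half {σ δ : ℝ} (hσ : 0 < σ) (hσ1 : σ < 1 / 2) :
    (fun t : ℝ => doubleSumMajorant σ t δ) =O[atTop]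
      fun t : ℝ => t ^ ((1 - σ) * δ) := by
  refine IsBigO.of_bound (1 / (1 - 2 * σ)) ?_
  filter_upwards [eventually_gt_atTop 0] with t ht
  have hs : 0 < 1 - 2 * σ := by linarith
  rw [Real.norm_of_nonneg (doubleSumMajorant_nonneg ht.le σ δ), Real.norm_of_nonneg (by positivity)]
  have h := sum_range_rpow_sub_one_le hs (by linarith) ⌊t ^ δ⌋₊
  have h2 : (⌊t ^ δ⌋₊ : ℝ) ^ (1 - 2 * σ) ≤ (t ^ δ) ^ (1 - 2 * σ) :=
    Real.rpow_le_rpow (by positivity) (Nat.floor_le (by positivity)) hs.le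
  have e : 1 - 2 * σ - 1 = -(2 * σ) := by ring
  rw [e] at h
  calc doubleSumMajorant σ t δ ≤ t ^ (σ * δ) * ((t ^ δ) ^ (1 - 2 * σ) / (1 - 2 * σ)) :=
        mul_le_mul_of_nonneg_left (h.trans (div_le_div_of_nonneg_right h2 hs.le)) (by positivity)
    _ = 1 / (1 - 2 * σ) * (t ^ (σ * δ) * t ^ (δ * (1 - 2 * σ))) := by
        rw [← Real.rpow_mul ht.le]; ring
    _ = _ := by
        rw [← Real.rpow_add ht]
        ring_nf

/-- Here ∑ m^(-2σ) converges. -/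
lemma doubleSumMajorant_isBigO_of_half_lt {σ δ : ℝ} (hσ : 1 / 2 < σ) :
    (fun t : ℝ => doubleSumMajorant σ t δ) =O[atTop] fun t : ℝ => t ^ (σ * δ) := by
  have hsum : Summable fun k : ℕ => ((k : ℝ) + 1) ^ (-(2 * σ)) := by
    have := (summable_nat_add_iff 1).2 (Real.summable_nat_rpow.2 (by linarith : -(2 * σ) < -1))
    simpa using this
  refine IsBigO.of_bound (∑' k : ℕ, ((k : ℝ) + 1) ^ (-(2 * σ))) ?_
  filter_upwards [eventually_gt_atTop 0] with t ht
  rw [Real.norm_of_nonneg (doubleSumMajorant_nonneg ht.le σ δ), Real.norm_of_nonneg (by positivity),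
    doubleSumMajorant, mul_comm]
  exact mul_le_mul_of_nonneg_right (hsum.sum_le_tsum _ fun _ _ => by positivity) (by positivity)

/-- The sum is harmonic, hence at most 1 + log t, which is at most 2 log t once t ≥ e. -/
lemma doubleSumMajorant_half_isBigO {δ : ℝ} (hδ : 0 ≤ δ) (hδ1 : δ ≤ 1) :
    (fun t : ℝ => doubleSumMajorant (1 / 2) t δ) =O[atTop]
      fun t : ℝ => t ^ (δ / 2) * Real.log t := by
  refine IsBigO.of_bound 2 ?_
  filter_upwards [eventually_ge_atTop (Real.exp 1)] with t ht
  have ht1 : 1 ≤ t := le_trans (by linarith [Real.add_one_le_exp 1]) ht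
  have ht0 : 0 < t := by linarith
  have hlog : 1 ≤ Real.log t := (Real.le_log_iff_exp_le ht0).2 ht
  rw [Real.norm_of_nonneg (doubleSumMajorant_nonneg ht0.le _ δ),
    Real.norm_of_nonneg (by positivity)]
  have hfloor : 1 ≤ ⌊t ^ δ⌋₊ := Nat.le_floor (by simpa using Real.one_le_rpow ht1 hδ)
  have hsum : ∑ k ∈ Finset.range ⌊t ^ δ⌋₊, ((k : ℝ) + 1) ^ (-(2 * (1 / 2 : ℝ))) ≤
      2 * Real.log t := by
    have h := harmonic_le_one_add_log ⌊t ^ δ⌋₊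
    have h2 : Real.log ⌊t ^ δ⌋₊ ≤ Real.log t := by
      refine Real.log_le_log (by exact_mod_cast hfloor) ((Nat.floor_le (by positivity)).trans ?_)
      exact (Real.rpow_le_rpow_of_exponent_le ht1 hδ1).trans_eq (Real.rpow_one t)
    have e : ∑ k ∈ Finset.range ⌊t ^ δ⌋₊, ((k : ℝ) + 1) ^ (-(2 * (1 / 2 : ℝ))) =
        harmonic ⌊t ^ δ⌋₊ := by
      rw [harmonic]
      push_cast
      refine Finset.sum_congr rfl fun k _ => ?_
      rw [← Real.rpow_neg_one]
      norm_num
    rw [e]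
    linarith
  calc doubleSumMajorant (1 / 2) t δ ≤ t ^ (1 / 2 * δ) * (2 * Real.log t) :=
        mul_le_mul_of_nonneg_left hsum (by positivity)
    _ = _ := by
        rw [show 1 / 2 * δ = δ / 2 by ring]
        ring

theorem mainTheorem6 :
    ∃ G : ℝ → ℝ → ℝ → ℝ,
      (∀ σ δ : ℝ, 0 < σ → σ < 1 → 0 < δ → δ < 1 →
        ∃ A B : ℝ → ℂ,
          (∀ t : ℝ, doubleSumS1 σ t δ = A t + B t) ∧
          Asymptotics.IsBigO Filter.atTop A (fun t : ℝ => t ^ (1 / 2 - σ) * G σ t δ) ∧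
          Asymptotics.IsBigO Filter.atTop B (fun t : ℝ => t ^ ((1 - σ) * δ) / t ^ σ)) ∧
      (∀ σ δ : ℝ, 0 < σ → σ < 1 → σ ≠ 1 / 2 → 0 < δ → δ < 1 →
        Asymptotics.IsBigO Filter.atTop (fun t : ℝ => G σ t δ)
          (fun t : ℝ => t ^ ((1 - σ) * δ) + t ^ (σ * δ))) ∧
      (∀ δ : ℝ, 0 < δ → δ < 1 →
        Asymptotics.IsBigO Filter.atTop (fun t : ℝ => G (1 / 2) t δ)
          (fun t : ℝ => t ^ (δ / 2) * Real.log t)) := by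
  refine ⟨doubleSumMajorant, fun σ δ hσ hσ1 _ hδ1 => ⟨fun t => doubleSumS1 σ t δ, 0, fun t => ?_,
    doubleSumS1_isBigO hσ hσ1.le hδ1, isBigO_zero _ _⟩, fun σ δ hσ hσ1 hne hδ hδ1 => ?_,
    fun δ hδ hδ1 => doubleSumMajorant_half_isBigO hδ.le hδ1.le⟩
  · simp
  · rcases lt_or_gt_of_ne hne with h | h
    · refine (doubleSumMajorant_isBigO_of_lt_half hσ h).trans (IsBigO.of_bound 1 ?_)
      filter_upwards [eventually_gt_atTop 0] with t ht
      rw [one_mul, Real.norm_of_nonneg (by positivity), Real.norm_of_nonneg (by positivity)]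
      exact le_add_of_nonneg_right (by positivity)
    · refine (doubleSumMajorant_isBigO_of_half_lt h).trans (IsBigO.of_bound 1 ?_)
      filter_upwards [eventually_gt_atTop 0] with t ht
      rw [one_mul, Real.norm_of_nonneg (by positivity), Real.norm_of_nonneg (by positivity)]
      exact le_add_of_nonneg_left (by positivity)
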